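/- Let $n\ge 1$, let $\Phi^+=\{e_i-e_j : 1\le i<j\le n+1\}$ be the positive roots of type $A_n$ in $\mathbb{R}^{n+1}$, with simple roots $e_i-e_{i+1}$ and inner product $(\cdot,\cdot)$, and let $W_a=W(\widetilde A_n)$ be the group generated by the affine reflections $s_{\alpha,p}(x)=x-((x,\alpha)-p)\alpha$ with $\alpha\in\pm\Phi^+$ and $p\in\mathbb{Z}$. Put $A_e=\{x : 0<(x,\alpha)<1\ \text{for all }\alpha\in\Phi^+\}$ and, for $w\in W_a$, $A_w=wA_e$. An integer vector $\lambda=(\lambda_{i,j})_{i<j}$ is called admitted if there is $w\in W_a$ with $A_w=\bigcap_{i<j}\{x : \lambda_{i,j}<(x,e_i-e_j)<\lambda_{i,j}+1\}$ and $A_w\subseteq\{x : 0<(x,e_i-e_{i+1})<1\ \text{for } 1\le i\le n\}$. For such $\lambda$ let $$X[\lambda]=\Big\{x\in\mathbb{R}^{\Phi^+} : x_{i,j}=\sum_{r=i}^{j-1}x_{r,r+1}+\lambda_{i,j}\ \text{ for all } 1\le i<j\le n+1\Big\}.$$ The Shi variety is $\widehat X=\bigcup_{\lambda\ \mathrm{admitted}}X[\lambda]\subseteq\mathbb{R}^{\Phi^+}$,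 and $H^0(\widehat X)$ denotes the set of its irreducible components for the Zariski topology. For $w\in S_{n+1}=W(A_n)$ let $F(w)$ be the affine bijection of $\mathbb{R}^{\Phi^+}$ given by $$F(w)(x)_{i,j}=\begin{cases}x_{w^{-1}(i),w^{-1}(j)} & \text{if } w^{-1}(i)<w^{-1}(j),\\ -x_{w^{-1}(j),w^{-1}(i)}-1 & \text{if } w^{-1}(i)>w^{-1}(j),\end{cases}\qquad i<j .$$ This defines an action of $S_{n+1}$ on $\mathbb{R}^{\Phi^+}$. Theorem. For every $w\in S_{n+1}$ and $C\in H^0(\widehat X)$ one has $w\diamond C:=F(w)(C)\in H^0(\widehat X)$, so that $S_{n+1}$ acts on $H^0(\widehat X)$. There is a bijection $\Psi$ from the set of $(n+1)$-cycles of $S_{n+1}$ to $H^0(\widehat X)$ with $\Psi(wcw^{-1})=w\diamond\Psi(c)$ for all $w\in S_{n+1}$ and all $(n+1)$-cycles $c$, and with $\Psi\big((1\ 2\ \cdots\ n+1)\big)=X[0]$. In particular $|H^0(\widehat X)|=n!$. -/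

import Mathlib

namespace ShiTypeA

/-- Positive roots of `A_n`: the pair `(i, j)` with `i < j` stands for `e_i - e_j`,
where `e_0, …, e_n` is the canonical basis of `ℝ^(n+1)` (indices start at `0`). -/
abbrev PosRoot (n : ℕ) : Type :=
  {p : Fin (n + 1) × Fin (n + 1) // p.1 < p.2}

/-- The simple root `e_r - e_(r+1)`. -/
def simpleRoot {n : ℕ} (r : Fin n) : PosRoot n :=
  ⟨(r.castSucc, r.succ), Fin.castSucc_lt_succ⟩

/-- The real vector space with one coordinate for each positive root. -/
abbrev Y (n : ℕ) : Type := PosRoot n → ℝ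

/-! ### The affine Weyl group and its alcoves

The root `α = e_i - e_j` satisfies `(α, α) = 2`, hence `α = α^∨`, and `(x, α) = x i - x j`. -/

/-- The root `e_i - e_j` as a vector. -/
def rootVec {n : ℕ} (i j : Fin (n + 1)) : Fin (n + 1) → ℝ :=
  Pi.single i 1 - Pi.single j 1

/-- The affine reflection `s_{α,p} : x ↦ x - ((x, α^∨) - p) α` for `α = e_i - e_j`. -/
def affineReflection {n : ℕ} (i j : Fin (n + 1)) (hij : i ≠ j) (p : ℤ) :
    Equiv.Perm (Fin (n + 1) → ℝ) :=
  Function.Involutive.toPerm (fun x => x - ((x i - x j) - (p : ℝ)) • rootVec i j) (by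
    intro x
    funext k
    simp only [rootVec, Pi.sub_apply, Pi.smul_apply, smul_eq_mul, Pi.single_eq_same,
      Pi.single_eq_of_ne hij, Pi.single_eq_of_ne hij.symm]
    ring)

/-- The affine Weyl group `W(Ã_n)`, generated by all the affine reflections `s_{α,p}`. -/
def affineWeylGroup (n : ℕ) : Subgroup (Equiv.Perm (Fin (n + 1) → ℝ)) :=
  Subgroup.closure {g | ∃ (i j : Fin (n + 1)) (hij : i ≠ j) (p : ℤ), g = affineReflection i j hij p}

/-- The intersection over the positive roots `α` of the width-one strips
`{x | k α < (x, α^∨) < k α + 1}`. -/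
def stripIntersection {n : ℕ} (k : PosRoot n → ℤ) : Set (Fin (n + 1) → ℝ) :=
  {x | ∀ a : PosRoot n, (k a : ℝ) < x a.1.1 - x a.1.2 ∧ x a.1.1 - x a.1.2 < (k a : ℝ) + 1}

/-- The alcove `A_w = w A_e`, where `A_e` is the intersection of the strips with `k = 0`. -/
def alcove {n : ℕ} (w : Equiv.Perm (Fin (n + 1) → ℝ)) : Set (Fin (n + 1) → ℝ) :=
  w '' stripIntersection (0 : PosRoot n → ℤ)

/-- The fundamental parallelepiped `P_H`, the intersection of the strips
`{x | 0 < (x, α^∨) < 1}` over the simple roots `α`. -/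
def parallelepiped (n : ℕ) : Set (Fin (n + 1) → ℝ) :=
  {x | ∀ r : Fin n, 0 < x r.castSucc - x r.succ ∧ x r.castSucc - x r.succ < 1}

/-- `lam` is admitted: it is the tuple `(k(w, α))_α` of some `w` in the affine Weyl group
whose alcove lies in `P_H`. -/
def IsAdmitted {n : ℕ} (lam : PosRoot n → ℤ) : Prop :=
  ∃ w ∈ affineWeylGroup n, alcove w = stripIntersection lam ∧ alcove w ⊆ parallelepiped n

/-! ### The Shi variety and its irreducible components -/

/-- The set `X[lam]`, cut out by the equations
`x_{i,j} = x_{i,i+1} + x_{i+1,i+2} + ⋯ + x_{j-1,j} + lam_{i,j}` for `i < j`. -/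
def component {n : ℕ} (lam : PosRoot n → ℤ) : Set (Y n) :=
  {x | ∀ a : PosRoot n,
    x a = (∑ r : Fin n with a.1.1 ≤ r.castSucc ∧ r.succ ≤ a.1.2, x (simpleRoot r)) + (lam a : ℝ)}

/-- The Shi variety of `W(Ã_n)`. -/
def shiVariety (n : ℕ) : Set (Y n) :=
  {x | ∃ lam : PosRoot n → ℤ, IsAdmitted lam ∧ x ∈ component lam}

/-- The Zariski topology on affine space: closed sets are the common zero sets of families
of polynomials. -/
@[reducible] def zariskiTopology (ι k : Type*) [Field k] : TopologicalSpace (ι → k) :=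
  TopologicalSpace.ofClosed
    {Z | ∃ S : Set (MvPolynomial ι k), Z = {x | ∀ f ∈ S, MvPolynomial.eval x f = 0}}
    ⟨{1}, by ext x; simp⟩
    (by
      intro A hA
      refine ⟨{f | ∀ x, (∀ Z ∈ A, x ∈ Z) → MvPolynomial.eval x f = 0}, ?_⟩
      ext x
      simp only [Set.mem_sInter, Set.mem_ofPred_eq]
      refine ⟨fun h f hf => hf x h, fun h Z hZ => ?_⟩
      obtain ⟨S, rfl⟩ := hA hZ
      intro f hf
      exact h f (fun y hy => hy _ hZ f hf))
    (by
      rintro _ ⟨S, rfl⟩ _ ⟨T, rfl⟩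
      refine ⟨{h | ∃ f ∈ S, ∃ g ∈ T, h = f * g}, ?_⟩
      ext x
      simp only [Set.mem_union, Set.mem_ofPred_eq]
      constructor
      · rintro (h | h) _ ⟨f, hf, g, hg, rfl⟩
        · simp [h f hf]
        · simp [h g hg]
      · intro h
        by_contra! hc
        obtain ⟨⟨f, hf, hf0⟩, g, hg, hg0⟩ := hc
        have := h _ ⟨f, hf, g, hg, rfl⟩
        rw [map_mul] at this
        exact (mul_ne_zero hf0 hg0) this)

/-- `H^0`: the irreducible components of the Shi variety for the Zariski topology induced from
`Y n`, regarded as subsets of `Y n`. -/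
def H0 (n : ℕ) : Set (Set (Y n)) :=
  (fun D : Set (shiVariety n) => (Subtype.val '' D : Set (Y n))) ''
    @irreducibleComponents (shiVariety n)
      (TopologicalSpace.induced Subtype.val (zariskiTopology (PosRoot n) ℝ))

/-! ### The action of `W(A_n)`, the symmetric group on `n + 1` letters -/

/-- The coordinates of `x` extended to all pairs by `x_{j,i} = -x_{i,j}`. -/
noncomputable def antisymm {n : ℕ} (x : Y n) (i j : Fin (n + 1)) : ℝ :=
  if h : i < j then x ⟨(i, j), h⟩ else if h : j < i then -x ⟨(j, i), h⟩ else 0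

/-- The affine map `F(w)` on `Y n`, for `w` in the symmetric group. The number subtracted is `1`
exactly when `e_i - e_j` lies in the inversion set `N(w) = {ξ ∈ Φ⁺ | w⁻¹ ξ ∈ Φ⁻}`. -/
noncomputable def phiMap {n : ℕ} (w : Equiv.Perm (Fin (n + 1))) (x : Y n) : Y n :=
  fun a => antisymm x (w⁻¹ a.1.1) (w⁻¹ a.1.2) - if w⁻¹ a.1.2 < w⁻¹ a.1.1 then 1 else 0

theorem phiMap_one {n : ℕ} (x : Y n) : phiMap 1 x = x := by
  funext a
  have h := a.2
  simp [phiMap, antisymm, h, h.not_gt]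

theorem phiMap_mul {n : ℕ} (u w : Equiv.Perm (Fin (n + 1))) (x : Y n) :
    phiMap (u * w) x = phiMap u (phiMap w x) := by
  have key : ∀ i j : Fin (n + 1), i ≠ j →
      antisymm x (w⁻¹ i) (w⁻¹ j) - (if w⁻¹ j < w⁻¹ i then 1 else 0) =
        antisymm (phiMap w x) i j - (if j < i then 1 else 0) := by
    intro i j hne
    have hne' : w⁻¹ i ≠ w⁻¹ j := fun h => hne (w⁻¹.injective h)
    rcases lt_or_gt_of_ne hne with h | h <;> rcases lt_or_gt_of_ne hne' with h' | h' <;>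
      simp only [phiMap, antisymm, h, h', h.not_gt, h'.not_gt, dif_pos, if_true, if_false,
        dite_false] <;> ring
  funext a
  have := key (u⁻¹ a.1.1) (u⁻¹ a.1.2) (fun h => a.2.ne (u⁻¹.injective h))
  rw [phiMap, mul_inv_rev, Equiv.Perm.mul_apply, Equiv.Perm.mul_apply, this]
  rfl

/-- The `Φ⁺`-representation `F` restricted to the finite Weyl group `W(A_n)`. -/
noncomputable def phiRep (n : ℕ) : Equiv.Perm (Fin (n + 1)) →* Equiv.Perm (Y n) where
  toFun w :=
    { toFun := phiMap w
      invFun := phiMap w⁻¹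
      left_inv := fun x => by rw [← phiMap_mul, inv_mul_cancel, phiMap_one]
      right_inv := fun x => by rw [← phiMap_mul, mul_inv_cancel, phiMap_one] }
  map_one' := by ext1 x; exact phiMap_one x
  map_mul' u w := by ext1 x; exact phiMap_mul u w x

/-- On the reflection `s_α`, `α = e_k - e_l` (the transposition of `k` and `l`), `F` is the affine
map with matrix entry in row `γ` and column `β` equal to `1` if `s_α β = γ`, to `-1` if
`s_α β = -γ` and to `0` otherwise, and with constant term in coordinate `γ` equal to `0` if `s_α γ`
is a positive root and to `-1` if it is a negative root. As reflections generate the symmetric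
group, these formulas determine `F`. -/
theorem phiRep_reflection {n : ℕ} (a : PosRoot n) (x : Y n) (c : PosRoot n) :
    phiRep n (Equiv.swap a.1.1 a.1.2) x c =
      (∑ b : PosRoot n,
        (if Equiv.swap a.1.1 a.1.2 b.1.1 = c.1.1 ∧ Equiv.swap a.1.1 a.1.2 b.1.2 = c.1.2 then (1 : ℝ)
          else if Equiv.swap a.1.1 a.1.2 b.1.1 = c.1.2 ∧ Equiv.swap a.1.1 a.1.2 b.1.2 = c.1.1 then -1
          else 0) * x b) +
      (if Equiv.swap a.1.1 a.1.2 c.1.1 < Equiv.swap a.1.1 a.1.2 c.1.2 then 0 else -1) := by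
  change phiMap (Equiv.swap a.1.1 a.1.2) x c = _
  have hne : Equiv.swap a.1.1 a.1.2 c.1.1 ≠ Equiv.swap a.1.1 a.1.2 c.1.2 :=
    fun h => c.2.ne ((Equiv.swap a.1.1 a.1.2).injective h)
  obtain ⟨i, hi⟩ : ∃ i, Equiv.swap a.1.1 a.1.2 c.1.1 = i := ⟨_, rfl⟩
  obtain ⟨j, hj⟩ : ∃ j, Equiv.swap a.1.1 a.1.2 c.1.2 = j := ⟨_, rfl⟩
  have hi' : ∀ p, Equiv.swap a.1.1 a.1.2 p = c.1.1 ↔ p = i := by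
    intro p; rw [← hi]; exact (Equiv.eq_symm_apply _).symm
  have hj' : ∀ p, Equiv.swap a.1.1 a.1.2 p = c.1.2 ↔ p = j := by
    intro p; rw [← hj]; exact (Equiv.eq_symm_apply _).symm
  simp only [phiMap, Equiv.swap_inv, hi, hj, hi', hj']
  rw [hi, hj] at hne
  rcases lt_or_gt_of_ne hne with h | h
  · rw [Finset.sum_eq_single (⟨(i, j), h⟩ : PosRoot n)]
    · simp [antisymm, h, h.not_gt]
    · intro b _ hb
      have h1 : ¬ (b.1.1 = i ∧ b.1.2 = j) := fun e => hb (Subtype.ext (Prod.ext e.1 e.2))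
      have h2 : ¬ (b.1.1 = j ∧ b.1.2 = i) := by
        rintro ⟨e1, e2⟩
        have := b.2
        rw [e1, e2] at this
        exact lt_asymm h this
      simp [h1, h2]
    · simp
  · rw [Finset.sum_eq_single (⟨(j, i), h⟩ : PosRoot n)]
    · simp [antisymm, h, h.not_gt, hne, hne.symm]
      ring
    · intro b _ hb
      have h1 : ¬ (b.1.1 = j ∧ b.1.2 = i) := fun e => hb (Subtype.ext (Prod.ext e.1 e.2))
      have h2 : ¬ (b.1.1 = i ∧ b.1.2 = j) := by
        rintro ⟨e1, e2⟩
        have := b.2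
        rw [e1, e2] at this
        exact lt_asymm h this
      simp [h1, h2]
    · simp

/-- The circular permutations of the symmetric group on `n + 1` letters: the `(n+1)`-cycles. -/
def circularPermutations (n : ℕ) : Set (Equiv.Perm (Fin (n + 1))) :=
  {c | c.IsCycle ∧ c.support = Finset.univ}

end ShiTypeA

/-!
Replace the coordinates `x_{i,j}`, `i < j`, by `t_{i,j} = x_{i,j}` and `t_{j,i} = -x_{i,j} - 1`. In
these coordinates the symmetric group just permutes the indices. To a cycle `c` attach the affine
subspace `cycleComponent c` on which the numbers `t_{i,j} + d_c(i, j) / (n + 1)` are the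
differences `z_i - z_j` of a potential, where `d_c(i, j)` is the number of steps from `i` to `j` along
`c`. As `d_{w c w⁻¹}(w i, w j) = d_c(i, j)`, this construction is equivariant
(`image_phiRep_cycleComponent`).

These subspaces are the `X[λ]` with `λ` admitted. A point `x` off the walls determines `n + 1`
distinct points of the circle `ℝ / ℤ`, hence a cyclic order, which is the same thing as an
`(n + 1)`-cycle `c`. If `x` lies in the fundamental parallelepiped, its alcove is determined by `c`:
the differences `x_i - x_{i+1}` lie in `(0, 1)`, so `⌊x_i - x_j⌋` counts how often the path
`i → i + 1 → ⋯ → j` goes around the circle (`IsAdmitted.exists_component_eq`). Conversely, placing the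
points at the multiples of `1 / (n + 1)` gives an admitted vector for every `c`
(`exists_isAdmitted_component_eq`); that its alcove is `w A_e` with `w` in the affine Weyl group, and
not only in its extension by translations with nonzero coordinate sum, is arranged by rotating
the circle (`exists_perm_of_injective_sum_eq_zero`).

An affine subspace is closed and irreducible (`isIrreducible_of_lines`), and no `cycleComponent c`
contains another one (`eq_of_cycleComponent_subset`), so these finitely many sets are the
irreducible components of the Shi variety.
-/

namespace ShiTypeA

/-! ### Irreducible components and the Zariski topology -/

/-- If a subspace `X` is a finite union of closed irreducible sets none of which contains another,
then these sets are its irreducible components. -/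
theorem image_irreducibleComponents_eq_range {M ι : Type*} [TopologicalSpace M] [Finite ι]
    (X : Set M) (C : ι → Set M) (hX : ∀ x, x ∈ X ↔ ∃ i, x ∈ C i)
    (hclosed : ∀ i, IsClosed (C i)) (hirr : ∀ i, IsIrreducible (C i))
    (hanti : ∀ i j, C i ⊆ C j → i = j) :
    (fun D : Set X => (Subtype.val '' D : Set M)) '' irreducibleComponents X = Set.range C := by
  have hsub : ∀ i, C i ⊆ X := fun i x hx => (hX x).2 ⟨i, hx⟩
  have hcov : ∀ D : Set X, IsIrreducible D → ∃ i, Subtype.val '' D ⊆ C i := by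
    intro D hD
    have hD' : IsIrreducible (Subtype.val '' D : Set M) :=
      hD.image _ continuous_subtype_val.continuousOn
    have := isIrreducible_iff_sUnion_isClosed.1 hD' (Set.finite_range C).toFinset
      (by simpa using hclosed) (by
        rintro _ ⟨y, -, rfl⟩
        simpa using (hX y).1 y.2)
    simpa using this
  have hpre : ∀ i, IsIrreducible (Subtype.val ⁻¹' C i : Set X) := by
    intro i
    refine ⟨?_, ?_⟩
    · obtain ⟨x, hx⟩ := (hirr i).1
      exact ⟨⟨x, hsub i hx⟩, hx⟩
    · rintro _ _ ⟨u, hu, rfl⟩ ⟨v, hv, rfl⟩ ⟨x, hx, hxu⟩ ⟨y, hy, hyv⟩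
      obtain ⟨z, hz, hzuv⟩ := (hirr i).2 u v hu hv ⟨x, hx, hxu⟩ ⟨y, hy, hyv⟩
      exact ⟨⟨z, hsub i hz⟩, hz, hzuv⟩
  have himg : ∀ i, (Subtype.val '' (Subtype.val ⁻¹' C i : Set X) : Set M) = C i := by
    intro i
    rw [Subtype.image_preimage_coe, Set.inter_eq_right]
    exact hsub i
  ext Z
  constructor
  · rintro ⟨D, hD, rfl⟩
    obtain ⟨i, hi⟩ := hcov D hD.prop
    refine ⟨i, ?_⟩
    have : D = Subtype.val ⁻¹' C i :=
      hD.eq_of_subset (hpre i) (Set.image_subset_iff.1 hi)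
    simp only [this, himg]
  · rintro ⟨i, rfl⟩
    refine ⟨Subtype.val ⁻¹' C i, ⟨hpre i, fun E hE hle => ?_⟩, himg i⟩
    obtain ⟨j, hj⟩ := hcov E hE
    have hij : i = j := hanti i j (by
      rw [← himg i]
      exact (Set.image_mono hle).trans hj)
    subst hij
    exact Set.image_subset_iff.1 hj

theorem isClosed_zariskiTopology_iff {ι k : Type*} [Field k] (Z : Set (ι → k)) :
    @IsClosed _ (zariskiTopology ι k) Z ↔
      ∃ S : Set (MvPolynomial ι k), Z = {x | ∀ f ∈ S, MvPolynomial.eval x f = 0} := by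
  rw [← @isOpen_compl_iff _ _ (zariskiTopology ι k)]
  change Zᶜᶜ ∈ _ ↔ _
  rw [compl_compl]
  rfl

/-- The restriction of a polynomial to the line through `p` and `q`. -/
theorem exists_polynomial_eval_line {ι k : Type*} [Field k] (f : MvPolynomial ι k)
    (p q : ι → k) :
    ∃ P : Polynomial k, ∀ t : k, P.eval t = MvPolynomial.eval (fun i => p i + t * (q i - p i)) f := by
  refine ⟨MvPolynomial.aeval (fun i => Polynomial.C (p i) +
    Polynomial.X * Polynomial.C (q i - p i)) f, fun t => ?_⟩
  induction f using MvPolynomial.induction_on with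
  | C a => simp
  | add f g hf hg => rw [map_add, map_add, Polynomial.eval_add, hf, hg]
  | mul_X f i hf => rw [map_mul, map_mul, Polynomial.eval_mul, hf]; simp

/-- Over an infinite field, a nonempty set which contains the line through any two of its points
is irreducible for the Zariski topology: polynomials not vanishing at `p` and at `q`
respectively are both nonzero somewhere on the line through `p` and `q`. -/
theorem isIrreducible_of_lines {ι k : Type*} [Field k] [Infinite k] (A : Set (ι → k))
    (hne : A.Nonempty)
    (hline : ∀ p ∈ A, ∀ q ∈ A, ∀ t : k, (fun i => p i + t * (q i - p i)) ∈ A) :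
    @IsIrreducible _ (zariskiTopology ι k) A := by
  let _ := zariskiTopology ι k
  have hpoly : ∀ u : Set (ι → k), IsOpen u → ∀ p ∈ u, ∃ f : MvPolynomial ι k,
      MvPolynomial.eval p f ≠ 0 ∧ ∀ x, MvPolynomial.eval x f ≠ 0 → x ∈ u := by
    intro u hu p hp
    obtain ⟨S, hS⟩ := (isClosed_zariskiTopology_iff uᶜ).1 hu.isClosed_compl
    have hmem : ∀ x, x ∈ u ↔ ∃ f ∈ S, MvPolynomial.eval x f ≠ 0 := by
      intro x
      have : x ∈ uᶜ ↔ ∀ f ∈ S, MvPolynomial.eval x f = 0 := by rw [hS]; rfl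
      rw [← not_iff_not]
      push Not
      exact this
    obtain ⟨f, hf, hfp⟩ := (hmem p).1 hp
    exact ⟨f, hfp, fun x hx => (hmem x).2 ⟨f, hf, hx⟩⟩
  refine ⟨hne, ?_⟩
  rintro u v hu hv ⟨p, hpA, hpu⟩ ⟨q, hqA, hqv⟩
  obtain ⟨f, hfp, hf⟩ := hpoly u hu p hpu
  obtain ⟨g, hgq, hg⟩ := hpoly v hv q hqv
  obtain ⟨P, hP⟩ := exists_polynomial_eval_line f p q
  obtain ⟨Q, hQ⟩ := exists_polynomial_eval_line g p q
  have hP0 : P ≠ 0 := by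
    rintro rfl
    apply hfp
    simpa using (hP 0).symm
  have hQ0 : Q ≠ 0 := by
    rintro rfl
    apply hgq
    simpa using (hQ 1).symm
  obtain ⟨t, ht⟩ : ∃ t, (P * Q).eval t ≠ 0 := by
    by_contra! h
    exact mul_ne_zero hP0 hQ0 (Polynomial.funext (by simpa using h))
  rw [Polynomial.eval_mul, hP, hQ] at ht
  exact ⟨_, hline p hpA q hqA t, hf _ (left_ne_zero_of_mul ht), hg _ (right_ne_zero_of_mul ht)⟩

theorem isClosed_component {n : ℕ} (lam : PosRoot n → ℤ) :
    @IsClosed _ (zariskiTopology (PosRoot n) ℝ) (component lam) := by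
  rw [isClosed_zariskiTopology_iff]
  refine ⟨Set.range fun a : PosRoot n => MvPolynomial.X a -
    (∑ r : Fin n with a.1.1 ≤ r.castSucc ∧ r.succ ≤ a.1.2, MvPolynomial.X (simpleRoot r)) -
    MvPolynomial.C (lam a : ℝ), ?_⟩
  ext x
  simp only [component, Set.mem_ofPred_eq, Set.forall_mem_range, map_sub, map_add,
    map_sum, MvPolynomial.eval_X, MvPolynomial.eval_C, sub_sub, sub_eq_zero]

theorem isIrreducible_component {n : ℕ} (lam : PosRoot n → ℤ) (hne : (component lam).Nonempty) :
    @IsIrreducible _ (zariskiTopology (PosRoot n) ℝ) (component lam) := by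
  refine isIrreducible_of_lines _ hne fun p hp q hq t a => ?_
  simp only [hp a, hq a, Finset.sum_add_distrib, ← Finset.mul_sum, Finset.sum_sub_distrib]
  ring

/-! ### Telescoping sums along the simple roots -/

theorem exists_primitive {M : Type*} [AddCommGroup M] {n : ℕ} (a : Fin n → M) :
    ∃ y : Fin (n + 1) → M, ∀ r, y r.succ = y r.castSucc + a r :=
  ⟨fun i => Fin.induction (motive := fun _ => M) 0 (fun r s => s + a r) i, fun _ => rfl⟩

theorem sum_simpleRoots_telescope {M : Type*} [AddCommGroup M] {n : ℕ} (y : Fin (n + 1) → M)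
    (i j : Fin (n + 1)) (hij : i ≤ j) :
    ∑ r : Fin n with i ≤ r.castSucc ∧ r.succ ≤ j, (y r.castSucc - y r.succ) = y i - y j := by
  induction j using Fin.induction with
  | zero =>
    obtain rfl : i = 0 := le_antisymm hij (Fin.zero_le i)
    rw [sub_self]
    refine Finset.sum_eq_zero fun r hr => ?_
    simp [Fin.succ_ne_zero] at hr
  | succ s ih =>
    rcases eq_or_lt_of_le hij with rfl | hlt
    · rw [sub_self]
      refine Finset.sum_eq_zero fun r hr => ?_
      simp only [Finset.mem_filter, Fin.le_def, Fin.val_castSucc, Fin.val_succ] at hr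
      omega
    · have hle : i ≤ s.castSucc := by
        simp only [Fin.le_def, Fin.lt_def, Fin.val_castSucc, Fin.val_succ] at hlt ⊢
        omega
      have : (Finset.univ.filter fun r : Fin n => i ≤ r.castSucc ∧ r.succ ≤ s.succ) =
          insert s (Finset.univ.filter fun r : Fin n => i ≤ r.castSucc ∧ r.succ ≤ s.castSucc) := by
        ext r
        simp only [Finset.mem_filter, Finset.mem_univ, true_and, Finset.mem_insert, Fin.le_def,
          Fin.val_castSucc, Fin.val_succ, Fin.ext_iff] at hle ⊢
        omega
      rw [this, Finset.sum_insert (by simp [Fin.le_def]), ih hle]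
      abel

/-! ### Cyclic orders -/

/-- A labelling `e` by residues modulo `n + 1` in which `c` becomes the translation by `1`. -/
def IsCyclicLabelling {n : ℕ} (c : Equiv.Perm (Fin (n + 1)))
    (e : Fin (n + 1) ≃ ZMod (n + 1)) : Prop :=
  ∀ i, e (c i) = e i + 1

/-- The number of steps by `c` needed to go from `i` to `j`: the least `k` with `c ^ k` sending `i`
to `j` (and `0` if there is none). -/
noncomputable def cyclicDist {n : ℕ} (c : Equiv.Perm (Fin (n + 1))) (i j : Fin (n + 1)) : ℕ :=
  sInf {k | (c ^ k) i = j}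

theorem finRotate_mem_circularPermutations {n : ℕ} (hn : 1 ≤ n) :
    finRotate (n + 1) ∈ circularPermutations n := by
  obtain ⟨m, rfl⟩ := Nat.exists_eq_add_of_le' hn
  exact ⟨isCycle_finRotate, support_finRotate⟩

theorem conj_mem_circularPermutations {n : ℕ} {c : Equiv.Perm (Fin (n + 1))}
    (hc : c ∈ circularPermutations n) (w : Equiv.Perm (Fin (n + 1))) :
    w * c * w⁻¹ ∈ circularPermutations n := by
  refine ⟨hc.1.conj, ?_⟩
  rw [Equiv.Perm.support_conj, hc.2, Finset.map_univ_equiv]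

theorem exists_isCyclicLabelling {n : ℕ} (hn : 1 ≤ n) {c : Equiv.Perm (Fin (n + 1))}
    (hc : c ∈ circularPermutations n) : ∃ e, IsCyclicLabelling c e := by
  have hrot := finRotate_mem_circularPermutations hn
  obtain ⟨s, hs⟩ := isConj_iff.1 (hc.1.isConj hrot.1 (by rw [hc.2, hrot.2]))
  -- `Fin (n + 1)` and `ZMod (n + 1)` are definitionally the same type with the same addition.
  refine ⟨(s : Fin (n + 1) ≃ Fin (n + 1)), fun i => ?_⟩
  have h : s (c i) = finRotate (n + 1) (s i) := by simp [← hs]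
  exact h.trans (finRotate_apply _)

theorem exists_circularPermutation {n : ℕ} (hn : 1 ≤ n) (e : Fin (n + 1) ≃ ZMod (n + 1)) :
    ∃ c ∈ circularPermutations n, IsCyclicLabelling c e := by
  let s : Equiv.Perm (Fin (n + 1)) := e
  refine ⟨s⁻¹ * finRotate (n + 1) * s⁻¹⁻¹,
    conj_mem_circularPermutations (finRotate_mem_circularPermutations hn) _, fun i => ?_⟩
  have h : s ((s⁻¹ * finRotate (n + 1) * s⁻¹⁻¹) i) = finRotate (n + 1) (s i) := by simp
  exact h.trans (finRotate_apply _)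

theorem isCyclicLabelling_finRotate (n : ℕ) :
    IsCyclicLabelling (finRotate (n + 1)) (Equiv.refl (Fin (n + 1))) :=
  fun i => finRotate_apply i

namespace IsCyclicLabelling

variable {n : ℕ} {c : Equiv.Perm (Fin (n + 1))} {e : Fin (n + 1) ≃ ZMod (n + 1)}

theorem apply_pow (h : IsCyclicLabelling c e) (k : ℕ) (i : Fin (n + 1)) :
    e ((c ^ k) i) = e i + k := by
  induction k with
  | zero => simp
  | succ k ih =>
    rw [pow_succ', Equiv.Perm.mul_apply, h, ih]
    push_cast
    ring

theorem cyclicDist_eq (h : IsCyclicLabelling c e) (i j : Fin (n + 1)) :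
    cyclicDist c i j = (e j - e i).val := by
  have hset : {k | (c ^ k) i = j} = {k : ℕ | (k : ZMod (n + 1)) = e j - e i} := by
    ext k
    simp only [Set.mem_ofPred_eq]
    rw [← e.injective.eq_iff, h.apply_pow, eq_sub_iff_add_eq, add_comm (e i)]
  rw [cyclicDist, hset]
  have hmem : (e j - e i).val ∈ {k : ℕ | (k : ZMod (n + 1)) = e j - e i} := by
    simp
  refine le_antisymm (Nat.sInf_le hmem) (le_csInf ⟨_, hmem⟩ fun k hk => ?_)
  rw [← (show (k : ZMod (n + 1)) = e j - e i from hk), ZMod.val_natCast]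
  exact Nat.mod_le _ _

theorem cyclicDist_add_cyclicDist (h : IsCyclicLabelling c e) {i j : Fin (n + 1)} (hij : i ≠ j) :
    cyclicDist c i j + cyclicDist c j i = n + 1 := by
  have hne : e i - e j ≠ 0 := sub_ne_zero.2 (e.injective.ne hij)
  have := ZMod.neg_val (e i - e j)
  rw [neg_sub, if_neg hne] at this
  rw [h.cyclicDist_eq, h.cyclicDist_eq, this]
  exact Nat.sub_add_cancel (ZMod.val_lt _).le

theorem one_le_cyclicDist (h : IsCyclicLabelling c e) {i j : Fin (n + 1)} (hij : i ≠ j) :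
    1 ≤ cyclicDist c i j := by
  rw [h.cyclicDist_eq, Nat.one_le_iff_ne_zero, Ne, ZMod.val_eq_zero, sub_eq_zero]
  exact e.injective.ne hij.symm

theorem eq_apply_of_cyclicDist_eq_one (h : IsCyclicLabelling c e) {i j : Fin (n + 1)}
    (hij : cyclicDist c i j = 1) : j = c i := by
  rw [h.cyclicDist_eq] at hij
  apply e.injective
  rw [h, ← sub_eq_iff_eq_add', ← ZMod.natCast_zmod_val (e j - e i), hij, Nat.cast_one]

theorem cyclicDist_apply (hn : 1 ≤ n) (h : IsCyclicLabelling c e) (i : Fin (n + 1)) :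
    cyclicDist c i (c i) = 1 := by
  have : Fact (1 < n + 1) := ⟨by omega⟩
  rw [h.cyclicDist_eq, h, add_sub_cancel_left, ZMod.val_one]

end IsCyclicLabelling

theorem cyclicDist_conj {n : ℕ} (c w : Equiv.Perm (Fin (n + 1))) (i j : Fin (n + 1)) :
    cyclicDist (w * c * w⁻¹) i j = cyclicDist c (w⁻¹ i) (w⁻¹ j) := by
  simp only [cyclicDist, conj_pow, Equiv.Perm.mul_apply]
  congr 1
  ext k
  simp only [Set.mem_ofPred_eq]
  exact (Equiv.Perm.eq_inv_iff_eq (f := w)).symm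

theorem ncard_circularPermutations {n : ℕ} (hn : 1 ≤ n) :
    (circularPermutations n).ncard = n.factorial := by
  have h : circularPermutations n =
      (Finset.univ.filter fun g : Equiv.Perm (Fin (n + 1)) => g.cycleType = {n + 1} :
        Finset (Equiv.Perm (Fin (n + 1)))) := by
    ext c
    simp only [circularPermutations, Finset.coe_filter, Finset.mem_univ, true_and,
      Set.mem_ofPred_eq]
    constructor
    · rintro ⟨hc, hs⟩
      rw [hc.cycleType, hs]
      simp
    · intro h
      have hc : c.IsCycle := by
        rw [← Equiv.Perm.card_cycleType_eq_one, h, Multiset.card_singleton]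
      refine ⟨hc, Finset.card_eq_iff_eq_univ _ |>.1 ?_⟩
      rw [hc.cycleType, Multiset.singleton_inj] at h
      simpa using h
  rw [h, Set.ncard_coe_finset, Equiv.Perm.card_of_cycleType_singleton (by omega) (by simp)]
  simp

/-! ### The component attached to a cycle -/

/-- The coordinate `t_{i,j}` of a point: `x_{i,j}` for `i < j`, and `-x_{j,i} - 1` for `j < i`.
In these coordinates the symmetric group acts by permuting the indices. -/
noncomputable def shiftedCoord {n : ℕ} (x : Y n) (i j : Fin (n + 1)) : ℝ :=
  antisymm x i j - if j < i then 1 else 0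

theorem shiftedCoord_of_lt {n : ℕ} (x : Y n) {i j : Fin (n + 1)} (h : i < j) :
    shiftedCoord x i j = x ⟨(i, j), h⟩ := by
  simp [shiftedCoord, antisymm, h, h.not_gt]

theorem shiftedCoord_of_gt {n : ℕ} (x : Y n) {i j : Fin (n + 1)} (h : j < i) :
    shiftedCoord x i j = -x ⟨(j, i), h⟩ - 1 := by
  simp [shiftedCoord, antisymm, h, h.not_gt]

theorem shiftedCoord_phiRep {n : ℕ} (w : Equiv.Perm (Fin (n + 1))) (x : Y n)
    {i j : Fin (n + 1)} (hij : i ≠ j) :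
    shiftedCoord (phiRep n w x) i j = shiftedCoord x (w⁻¹ i) (w⁻¹ j) := by
  have hlt : ∀ {k l : Fin (n + 1)} (h : k < l),
      phiRep n w x ⟨(k, l), h⟩ = shiftedCoord x (w⁻¹ k) (w⁻¹ l) := fun h => rfl
  rcases lt_or_gt_of_ne hij with h | h
  · rw [shiftedCoord_of_lt _ h, hlt]
  · rw [shiftedCoord_of_gt _ h, hlt]
    rcases lt_or_gt_of_ne (w⁻¹.injective.ne hij) with h' | h'
    · rw [shiftedCoord_of_lt _ h', shiftedCoord_of_gt _ h']
      ring
    · rw [shiftedCoord_of_lt _ h', shiftedCoord_of_gt _ h']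

/-- The affine subspace attached to a cycle `c`: the coordinates `t_{i,j} + d_c(i, j) / (n + 1)`,
where `d_c` is the cyclic distance, are the differences of a potential `z`. -/
def cycleComponent {n : ℕ} (c : Equiv.Perm (Fin (n + 1))) : Set (Y n) :=
  {x | ∃ z : Fin (n + 1) → ℝ, ∀ i j, i ≠ j →
    shiftedCoord x i j = z i - z j - (cyclicDist c i j : ℝ) / (n + 1)}

/-- As `t_{i,j} + t_{j,i} = -1` and `d_c(i, j) + d_c(j, i) = n + 1`, the conditions for `i < j`
suffice. -/
theorem mem_cycleComponent_iff {n : ℕ} {c : Equiv.Perm (Fin (n + 1))}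
    {e : Fin (n + 1) ≃ ZMod (n + 1)} (he : IsCyclicLabelling c e) (x : Y n) :
    x ∈ cycleComponent c ↔ ∃ z : Fin (n + 1) → ℝ, ∀ a : PosRoot n,
      x a = z a.1.1 - z a.1.2 - (cyclicDist c a.1.1 a.1.2 : ℝ) / (n + 1) := by
  constructor
  · rintro ⟨z, hz⟩
    refine ⟨z, fun a => ?_⟩
    rw [← hz _ _ a.2.ne, shiftedCoord_of_lt _ a.2]
  · rintro ⟨z, hz⟩
    refine ⟨z, fun i j hij => ?_⟩
    rcases lt_or_gt_of_ne hij with h | h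
    · rw [shiftedCoord_of_lt _ h, hz]
    · rw [shiftedCoord_of_gt _ h, hz]
      have : (cyclicDist c i j : ℝ) + cyclicDist c j i = n + 1 := by
        exact_mod_cast he.cyclicDist_add_cyclicDist hij
      rw [← eq_sub_iff_add_eq] at this
      rw [this]
      field_simp
      ring

theorem cycleComponent_nonempty {n : ℕ} {c : Equiv.Perm (Fin (n + 1))}
    {e : Fin (n + 1) ≃ ZMod (n + 1)} (he : IsCyclicLabelling c e) :
    (cycleComponent c).Nonempty :=
  ⟨fun a => 0 - 0 - (cyclicDist c a.1.1 a.1.2 : ℝ) / (n + 1),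
    (mem_cycleComponent_iff he _).2 ⟨fun _ => 0, fun _ => rfl⟩⟩

theorem image_phiRep_cycleComponent {n : ℕ} (w c : Equiv.Perm (Fin (n + 1))) :
    phiRep n w '' cycleComponent c = cycleComponent (w * c * w⁻¹) := by
  have hsub : ∀ w c : Equiv.Perm (Fin (n + 1)),
      phiRep n w '' cycleComponent c ⊆ cycleComponent (w * c * w⁻¹) := by
    rintro w c _ ⟨x, ⟨z, hz⟩, rfl⟩
    refine ⟨fun i => z (w⁻¹ i), fun i j hij => ?_⟩
    rw [shiftedCoord_phiRep w x hij, hz _ _ (w⁻¹.injective.ne hij), cyclicDist_conj]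
  refine (hsub w c).antisymm fun x hx => ⟨phiRep n w⁻¹ x, ?_, ?_⟩
  · have := hsub w⁻¹ _ ⟨x, hx, rfl⟩
    simpa [mul_assoc] using this
  · rw [← Equiv.Perm.mul_apply, ← map_mul, mul_inv_cancel, map_one, Equiv.Perm.one_apply]

/-- The potential of the inclusion telescopes along the cycle `c'`, so the distances
`d_c(i, c' i) ≥ 1` add up to the sum `n + 1` of the distances `d_{c'}(i, c' i) = 1`; hence they
are all `1`. -/
theorem eq_of_cycleComponent_subset {n : ℕ} (hn : 1 ≤ n) {c c' : Equiv.Perm (Fin (n + 1))}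
    {e e' : Fin (n + 1) ≃ ZMod (n + 1)} (he : IsCyclicLabelling c e)
    (he' : IsCyclicLabelling c' e') (hsub : cycleComponent c ⊆ cycleComponent c') : c = c' := by
  let x : Y n := fun a => 0 - 0 - (cyclicDist c a.1.1 a.1.2 : ℝ) / (n + 1)
  have hx : x ∈ cycleComponent c := (mem_cycleComponent_iff he _).2 ⟨fun _ => 0, fun _ => rfl⟩
  obtain ⟨z, hz⟩ := hsub hx
  have hlt : ∀ {i j : Fin (n + 1)}, i ≠ j →
      shiftedCoord x i j = - (cyclicDist c i j : ℝ) / (n + 1) := by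
    intro i j hij
    rcases lt_or_gt_of_ne hij with h | h
    · rw [shiftedCoord_of_lt _ h]
      simp only [x]
      ring
    · rw [shiftedCoord_of_gt _ h]
      have : (cyclicDist c i j : ℝ) + cyclicDist c j i = n + 1 := by
        exact_mod_cast he.cyclicDist_add_cyclicDist hij
      rw [← eq_sub_iff_add_eq] at this
      simp only [x]
      rw [this]
      field_simp
      ring
  have : Fact (1 < n + 1) := ⟨by omega⟩
  have hfix : ∀ i, i ≠ c' i := fun i h => by
    have := he' i
    rw [← h, left_eq_add] at this
    exact one_ne_zero this
  have hdist : ∀ i, (cyclicDist c i (c' i) : ℝ) = 1 - (n + 1) * (z i - z (c' i)) := by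
    intro i
    have h := hz i (c' i) (hfix i)
    rw [hlt (hfix i), he'.cyclicDist_apply hn] at h
    field_simp at h
    push_cast at h
    linarith
  have hsum : ∑ i, ((cyclicDist c i (c' i) : ℝ) - 1) = 0 := by
    have h : ∀ i, (cyclicDist c i (c' i) : ℝ) - 1 = (n + 1) * (z (c' i) - z i) := by
      intro i
      rw [hdist]
      ring
    rw [Finset.sum_congr rfl fun i _ => h i, ← Finset.mul_sum, Finset.sum_sub_distrib,
      Equiv.sum_comp c' z, sub_self, mul_zero]
  have hge : ∀ i ∈ Finset.univ, 0 ≤ (cyclicDist c i (c' i) : ℝ) - 1 := by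
    intro i _
    rw [sub_nonneg]
    exact_mod_cast he.one_le_cyclicDist (hfix i)
  ext1 i
  have h1 := (Finset.sum_eq_zero_iff_of_nonneg hge).1 hsum i (Finset.mem_univ i)
  rw [sub_eq_zero] at h1
  exact (he.eq_apply_of_cyclicDist_eq_one (by exact_mod_cast h1)).symm

/-! ### Elements of the affine Weyl group -/

theorem affineReflection_mem {n : ℕ} {i j : Fin (n + 1)} (hij : i ≠ j) (p : ℤ) :
    affineReflection i j hij p ∈ affineWeylGroup n :=
  Subgroup.subset_closure ⟨i, j, hij, p, rfl⟩

theorem affineReflection_apply {n : ℕ} {i j : Fin (n + 1)} (hij : i ≠ j) (p : ℤ)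
    (x : Fin (n + 1) → ℝ) :
    affineReflection i j hij p x = x - ((x i - x j) - (p : ℝ)) • rootVec i j := rfl

theorem affineReflection_zero_apply {n : ℕ} {i j : Fin (n + 1)} (hij : i ≠ j)
    (x : Fin (n + 1) → ℝ) (k : Fin (n + 1)) :
    affineReflection i j hij 0 x k = x (Equiv.swap i j k) := by
  rw [affineReflection_apply]
  rcases eq_or_ne k i with rfl | hi
  · simp [rootVec, hij]
  rcases eq_or_ne k j with rfl | hj
  · simp [rootVec, hi]
  · simp [rootVec, hi, hj, Equiv.swap_apply_of_ne_of_ne]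

theorem exists_mem_affineWeylGroup_perm {n : ℕ} (s : Equiv.Perm (Fin (n + 1))) :
    ∃ w ∈ affineWeylGroup n, ∀ x i, w x i = x (s i) := by
  induction s using Equiv.Perm.swap_induction_on with
  | one => exact ⟨1, one_mem _, fun _ _ => rfl⟩
  | swap_mul f a b hab ih =>
    obtain ⟨w, hw, h⟩ := ih
    refine ⟨w * affineReflection a b hab 0, mul_mem hw (affineReflection_mem hab 0), fun x i => ?_⟩
    rw [Equiv.Perm.mul_apply, h, affineReflection_zero_apply, Equiv.Perm.mul_apply]

/-- The lattice of the integral translations contained in the affine Weyl group. -/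
def translationLattice (n : ℕ) : AddSubgroup (Fin (n + 1) → ℤ) where
  carrier := {m | ∃ w ∈ affineWeylGroup n, ∀ x i, w x i = x i + (m i : ℝ)}
  zero_mem' := ⟨1, one_mem _, fun _ _ => by simp⟩
  add_mem' := by
    rintro m m' ⟨w, hw, h⟩ ⟨w', hw', h'⟩
    refine ⟨w * w', mul_mem hw hw', fun x i => ?_⟩
    rw [Equiv.Perm.mul_apply, h, h', Pi.add_apply]
    push_cast
    ring
  neg_mem' := by
    rintro m ⟨w, hw, h⟩
    refine ⟨w⁻¹, inv_mem hw, fun x i => ?_⟩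
    have := h (w⁻¹ x) i
    rw [show w (w⁻¹ x) = x from w.apply_symm_apply x] at this
    rw [this, Pi.neg_apply]
    push_cast
    ring

/-- The translation by the root `e_i - e_j` is the product `s_{α,1} s_{α,0}`. -/
theorem root_mem_translationLattice {n : ℕ} (i j : Fin (n + 1)) :
    (Pi.single i 1 - Pi.single j 1 : Fin (n + 1) → ℤ) ∈ translationLattice n := by
  rcases eq_or_ne i j with rfl | hij
  · rw [sub_self]
    exact zero_mem _
  refine ⟨affineReflection i j hij 1 * affineReflection i j hij 0,
    mul_mem (affineReflection_mem hij 1) (affineReflection_mem hij 0), fun x k => ?_⟩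
  have hcast : (((Pi.single i 1 - Pi.single j 1 : Fin (n + 1) → ℤ) k : ℤ) : ℝ) =
      rootVec i j k := by
    simp only [rootVec, Pi.sub_apply, Pi.single_apply]
    push_cast
    rfl
  rw [Equiv.Perm.mul_apply, affineReflection_apply, hcast]
  simp only [affineReflection_zero_apply, Pi.sub_apply, Pi.smul_apply, smul_eq_mul,
    Equiv.swap_apply_left, Equiv.swap_apply_right]
  rw [← affineReflection_zero_apply hij x k, affineReflection_apply]
  simp only [Pi.sub_apply, Pi.smul_apply, smul_eq_mul]
  push_cast
  ring

theorem mem_translationLattice_of_sum_eq_zero {n : ℕ} {m : Fin (n + 1) → ℤ} (hm : ∑ i, m i = 0) :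
    m ∈ translationLattice n := by
  have h : m = ∑ i, m i • (Pi.single i 1 - Pi.single 0 1 : Fin (n + 1) → ℤ) := by
    funext k
    simp [Finset.sum_apply, mul_sub, Finset.sum_sub_distrib, Pi.single_apply, hm]
  rw [h]
  exact sum_mem fun i _ => zsmul_mem (root_mem_translationLattice i 0) _

theorem exists_mem_affineWeylGroup {n : ℕ} (s : Equiv.Perm (Fin (n + 1))) {m : Fin (n + 1) → ℤ}
    (hm : ∑ i, m i = 0) : ∃ w ∈ affineWeylGroup n, ∀ x i, w x i = x (s i) - (m i : ℝ) := by
  obtain ⟨w, hw, h⟩ := exists_mem_affineWeylGroup_perm s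
  obtain ⟨v, hv, h'⟩ := neg_mem (mem_translationLattice_of_sum_eq_zero hm)
  refine ⟨v * w, mul_mem hv hw, fun x i => ?_⟩
  rw [Equiv.Perm.mul_apply, h', h, Pi.neg_apply]
  push_cast
  ring

/-! ### Admitted vectors as integer parts -/

/-- The vector `λ_{i,j} = ⌊(D_j - D_i) / (n + 1)⌋`, that is `⌊p_i - p_j⌋` for the point
`p = -D / (n + 1)`. -/
def floorVec {n : ℕ} (D : Fin (n + 1) → ℤ) : PosRoot n → ℤ :=
  fun a => (D a.1.2 - D a.1.1) / (n + 1)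

/-- Translating `D` by a constant `t` does not change `floorVec D`. -/
theorem floorVec_eq {n : ℕ} {D m : Fin (n + 1) → ℤ} {s : Equiv.Perm (Fin (n + 1))} {t : ℤ}
    (h : ∀ i, D i + t = (n + 1) * m i + (s i).val) (a : PosRoot n) :
    floorVec D a = m a.1.2 - m a.1.1 + if s a.1.1 < s a.1.2 then 0 else -1 := by
  have hD : D a.1.2 - D a.1.1 =
      ((s a.1.2).val - (s a.1.1).val : ℤ) + (n + 1) * (m a.1.2 - m a.1.1) := by
    linear_combination h a.1.2 - h a.1.1
  have hpos : (0 : ℤ) < n + 1 := by positivity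
  rw [floorVec, hD, Int.add_mul_ediv_left _ _ hpos.ne', add_comm]
  congr 1
  have h1 := (s a.1.1).isLt
  have h2 := (s a.1.2).isLt
  have hne : (s a.1.1).val ≠ (s a.1.2).val :=
    fun h => a.2.ne (s.injective (Fin.ext h))
  split_ifs with hlt
  · rw [Fin.lt_def] at hlt
    exact Int.ediv_eq_zero_of_lt (by omega) (by omega)
  · rw [Fin.lt_def] at hlt
    rw [Int.ediv_eq_iff_of_pos hpos]
    constructor <;> omega

theorem exists_perm_of_injective {n : ℕ} {D : Fin (n + 1) → ℤ}
    (hD : Function.Injective fun i => (D i : ZMod (n + 1))) :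
    ∃ (s : Equiv.Perm (Fin (n + 1))) (m : Fin (n + 1) → ℤ),
      ∀ i, D i = (n + 1) * m i + (s i).val := by
  have hbij : Function.Bijective (fun i => (D i : ZMod (n + 1)) : Fin (n + 1) → Fin (n + 1)) :=
    Finite.injective_iff_bijective.1 hD
  refine ⟨Equiv.ofBijective _ hbij, fun i => D i / (n + 1), fun i => ?_⟩
  have h : (((D i : ZMod (n + 1)).val : ℕ) : ℤ) = D i % ((n + 1 : ℕ) : ℤ) := ZMod.val_intCast _
  push_cast at h
  exact (Int.mul_ediv_add_emod (D i) (n + 1)).symm.trans (by rw [← h]; rfl)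

/-- Translating `D` by a constant permutes its residues and changes the sum of the integral parts by
that constant, so these can be assumed to sum to zero, as is required in the affine Weyl group. -/
theorem exists_perm_of_injective_sum_eq_zero {n : ℕ} {D : Fin (n + 1) → ℤ}
    (hD : Function.Injective fun i => (D i : ZMod (n + 1))) :
    ∃ (s : Equiv.Perm (Fin (n + 1))) (m : Fin (n + 1) → ℤ) (t : ℤ), ∑ i, m i = 0 ∧
      ∀ i, D i + t = (n + 1) * m i + (s i).val := by
  obtain ⟨s₀, m₀, h₀⟩ := exists_perm_of_injective hD
  have hD' : Function.Injective fun i => ((D i + -∑ k, m₀ k : ℤ) : ZMod (n + 1)) := by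
    intro i j hij
    push_cast at hij
    exact hD (add_right_cancel hij)
  obtain ⟨s, m, h⟩ := exists_perm_of_injective hD'
  refine ⟨s, m, _, ?_, h⟩
  have hsum : ∀ s : Equiv.Perm (Fin (n + 1)),
      ∑ i, ((s i).val : ℤ) = ∑ i : Fin (n + 1), (i.val : ℤ) :=
    fun s => Equiv.sum_comp s fun i => (i.val : ℤ)
  have e₀ := Finset.sum_congr (rfl : (Finset.univ : Finset (Fin (n + 1))) = _) fun i _ => h₀ i
  have e₁ := Finset.sum_congr (rfl : (Finset.univ : Finset (Fin (n + 1))) = _) fun i _ => h i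
  rw [Finset.sum_add_distrib, ← Finset.mul_sum, hsum] at e₀
  rw [Finset.sum_add_distrib, Finset.sum_add_distrib, ← Finset.mul_sum, hsum, Finset.sum_const,
    Finset.card_univ, Fintype.card_fin, nsmul_eq_mul] at e₁
  push_cast at e₁
  have : ((n : ℤ) + 1) * ∑ i, m i = 0 := by linear_combination e₀ - e₁
  exact (mul_eq_zero.1 this).resolve_left (by positivity)

theorem isAdmitted_floorVec {n : ℕ} {D : Fin (n + 1) → ℤ}
    (hD : Function.Injective fun i => (D i : ZMod (n + 1)))
    (hs : ∀ r, floorVec D (simpleRoot r) = 0) : IsAdmitted (floorVec D) := by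
  obtain ⟨s, m, t, hm, h⟩ := exists_perm_of_injective_sum_eq_zero hD
  obtain ⟨w, hw, hwx⟩ := exists_mem_affineWeylGroup s hm
  have halc : alcove w = stripIntersection (floorVec D) := by
    ext y
    constructor
    · rintro ⟨x, hx, rfl⟩ a
      rw [floorVec_eq h, hwx, hwx]
      rcases lt_or_gt_of_ne (s.injective.ne a.2.ne) with hlt | hlt
      · have := hx ⟨(s a.1.1, s a.1.2), hlt⟩
        simp only [Pi.zero_apply, Int.cast_zero] at this
        rw [if_pos hlt]
        push_cast
        constructor <;> linarith
      · have := hx ⟨(s a.1.2, s a.1.1), hlt⟩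
        simp only [Pi.zero_apply, Int.cast_zero] at this
        rw [if_neg hlt.not_gt]
        push_cast
        constructor <;> linarith
    · intro hy
      obtain ⟨x, rfl⟩ := w.surjective y
      refine ⟨x, fun a => ?_, rfl⟩
      obtain ⟨i, hi⟩ := s.surjective a.1.1
      obtain ⟨j, hj⟩ := s.surjective a.1.2
      have hlt : s i < s j := by
        rw [hi, hj]
        exact a.2
      rw [Pi.zero_apply, Int.cast_zero, ← hi, ← hj]
      rcases lt_or_gt_of_ne (fun e => hlt.ne (congrArg s e) : i ≠ j) with hij | hij
      · have := hy ⟨(i, j), hij⟩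
        rw [floorVec_eq h, hwx, hwx, if_pos hlt] at this
        push_cast at this
        constructor <;> linarith
      · have := hy ⟨(j, i), hij⟩
        rw [floorVec_eq h, hwx, hwx, if_neg hlt.not_gt] at this
        push_cast at this
        constructor <;> linarith
  refine ⟨w, hw, halc, ?_⟩
  rw [halc]
  intro x hx r
  have := hx (simpleRoot r)
  rw [hs, Int.cast_zero, zero_add] at this
  exact this

/-- With `λ_{i,j} + d_c(i, j) / (n + 1) = (D_j - D_i) / (n + 1)`, the equations of `X[λ]` say that the
numbers `x_{i,j} - λ_{i,j}` are the differences of a potential. -/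
theorem component_floorVec {n : ℕ} {c : Equiv.Perm (Fin (n + 1))}
    {e : Fin (n + 1) ≃ ZMod (n + 1)} (he : IsCyclicLabelling c e) {D : Fin (n + 1) → ℤ}
    (hD : ∀ i j, ((D j - D i : ℤ) : ZMod (n + 1)) = e j - e i)
    (hs : ∀ r, floorVec D (simpleRoot r) = 0) : component (floorVec D) = cycleComponent c := by
  have hdist : ∀ a : PosRoot n, (cyclicDist c a.1.1 a.1.2 : ℝ) / (n + 1) =
      (D a.1.2 - D a.1.1) / (n + 1) - floorVec D a := by
    intro a
    have h : (cyclicDist c a.1.1 a.1.2 : ℤ) = (D a.1.2 - D a.1.1) % (n + 1) := by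
      rw [he.cyclicDist_eq, ← hD, ZMod.val_intCast]
      push_cast
      rfl
    have h' := Int.emod_add_mul_ediv (D a.1.2 - D a.1.1) (n + 1)
    rw [← h] at h'
    have h'' : (cyclicDist c a.1.1 a.1.2 : ℝ) + (n + 1) * floorVec D a =
        D a.1.2 - D a.1.1 := by
      exact_mod_cast h'
    rw [← h'']
    field_simp
    ring
  ext x
  rw [mem_cycleComponent_iff he]
  constructor
  · intro hx
    obtain ⟨y, hy⟩ := exists_primitive fun r => -x (simpleRoot r)
    refine ⟨fun i => y i - D i / (n + 1), fun a => ?_⟩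
    have hsum := sum_simpleRoots_telescope y a.1.1 a.1.2 a.2.le
    simp only [hy, sub_add_cancel_left, neg_neg] at hsum
    rw [hx a, hsum, hdist]
    ring
  · rintro ⟨z, hz⟩
    have hz' : ∀ a : PosRoot n, x a = (z a.1.1 + D a.1.1 / (n + 1)) -
        (z a.1.2 + D a.1.2 / (n + 1)) + floorVec D a := by
      intro a
      rw [hz, hdist]
      ring
    intro a
    rw [hz' a, ← sum_simpleRoots_telescope (fun i => z i + D i / (n + 1)) _ _ a.2.le]
    congr 1
    refine Finset.sum_congr rfl fun r _ => ?_
    rw [hz', hs]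
    simp [simpleRoot]

/-- Every cycle comes from an admitted vector: add up the distances between consecutive indices. -/
theorem exists_isAdmitted_component_eq {n : ℕ} {c : Equiv.Perm (Fin (n + 1))}
    {e : Fin (n + 1) ≃ ZMod (n + 1)} (he : IsCyclicLabelling c e) :
    ∃ lam : PosRoot n → ℤ, IsAdmitted lam ∧ component lam = cycleComponent c := by
  obtain ⟨D, hD⟩ := exists_primitive fun r : Fin n => ((e r.succ - e r.castSucc).val : ℤ)
  have hmod : ∀ i, (D i : ZMod (n + 1)) = e i + (D 0 - e 0) := by
    intro i
    induction i using Fin.induction with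
    | zero => ring
    | succ r ih =>
      rw [hD]
      push_cast
      rw [ih, ZMod.natCast_zmod_val]
      ring
  have hs : ∀ r, floorVec D (simpleRoot r) = 0 := by
    intro r
    have h : D r.succ - D r.castSucc = ((e r.succ - e r.castSucc).val : ℤ) := by
      rw [hD]
      ring
    have hlt := ZMod.val_lt (e r.succ - e r.castSucc)
    change (D r.succ - D r.castSucc) / ((n : ℤ) + 1) = 0
    rw [h]
    exact Int.ediv_eq_zero_of_lt (by positivity) (by exact_mod_cast hlt)
  refine ⟨floorVec D, isAdmitted_floorVec (fun i j hij => ?_) hs,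
    component_floorVec he (fun i j => ?_) hs⟩
  · have hij : (D i : ZMod (n + 1)) = D j := hij
    rw [hmod i, hmod j] at hij
    exact e.injective (add_right_cancel hij)
  · push_cast
    rw [hmod i, hmod j]
    ring

theorem stripIntersection_zero_nonempty (n : ℕ) :
    (stripIntersection (0 : PosRoot n → ℤ)).Nonempty := by
  refine ⟨fun i => -(i.val : ℝ) / (n + 1), fun a => ?_⟩
  have h1 : (a.1.1.val : ℝ) < a.1.2.val := by exact_mod_cast a.2
  have h2 : (a.1.2.val : ℝ) < n + 1 := by exact_mod_cast a.1.2.isLt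
  have h3 : (0 : ℝ) ≤ a.1.1.val := by positivity
  simp only [Pi.zero_apply, Int.cast_zero, ← sub_div, zero_add]
  rw [div_lt_one (by positivity)]
  exact ⟨div_pos (by linarith) (by positivity), by linarith⟩

/-- Every admitted vector comes from a cycle: the cyclic order of the classes modulo `1` of the
coordinates of a point of the alcove. -/
theorem IsAdmitted.exists_component_eq {n : ℕ} (hn : 1 ≤ n) {lam : PosRoot n → ℤ}
    (hlam : IsAdmitted lam) :
    ∃ c ∈ circularPermutations n, component lam = cycleComponent c := by
  obtain ⟨w, -, hw, hpar⟩ := hlam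
  obtain ⟨x, hxw⟩ : (alcove w).Nonempty := (stripIntersection_zero_nonempty n).image w
  have hsimple := hpar hxw
  rw [hw] at hxw
  let m : Fin (n + 1) → ℤ := fun i => ⌊-x i⌋
  let f : Fin (n + 1) → ℝ := fun i => Int.fract (-x i)
  have hx : ∀ i, x i = -(m i + f i) := fun i => by
    simp only [m, f, Int.floor_add_fract, neg_neg]
  have hf0 : ∀ i, 0 ≤ f i := fun i => Int.fract_nonneg _
  have hf1 : ∀ i, f i < 1 := fun i => Int.fract_lt_one _
  have hne : ∀ i j, i < j → f i ≠ f j := by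
    intro i j hij hf
    have h := hxw ⟨(i, j), hij⟩
    rw [hx i, hx j, hf] at h
    have h1 : (lam ⟨(i, j), hij⟩ : ℝ) < ((m j - m i : ℤ) : ℝ) := by
      push_cast
      linarith [h.1]
    have h2 : ((m j - m i : ℤ) : ℝ) < ((lam ⟨(i, j), hij⟩ + 1 : ℤ) : ℝ) := by
      push_cast
      linarith [h.2]
    rw [Int.cast_lt] at h1 h2
    omega
  have hinj : Function.Injective f := by
    intro i j hij
    by_contra hne'
    rcases lt_or_gt_of_ne hne' with h | h
    · exact hne _ _ h hij
    · exact hne _ _ h hij.symm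
  let s : Equiv.Perm (Fin (n + 1)) := (Tuple.sort f)⁻¹
  have hmono : StrictMono (f ∘ Tuple.sort f) :=
    (Tuple.monotone_sort f).strictMono_of_injective (hinj.comp (Tuple.sort f).injective)
  have hslt : ∀ i j, s i < s j ↔ f i < f j := by
    intro i j
    rw [← hmono.lt_iff_lt]
    simp [s]
  let D : Fin (n + 1) → ℤ := fun i => (n + 1) * m i + (s i).val
  have hlamD : lam = floorVec D := by
    funext a
    rw [floorVec_eq (t := 0) (m := m) (s := s) (fun i => by simp [D])]
    have h := hxw a
    rw [hx, hx] at h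
    have h10 := hf0 a.1.1
    have h11 := hf1 a.1.1
    have h20 := hf0 a.1.2
    have h21 := hf1 a.1.2
    split_ifs with hlt
    · rw [hslt] at hlt
      have h1 : (lam a : ℝ) < ((m a.1.2 - m a.1.1 + 1 : ℤ) : ℝ) := by
        push_cast
        linarith
      have h2 : ((m a.1.2 - m a.1.1 : ℤ) : ℝ) < ((lam a + 1 : ℤ) : ℝ) := by
        push_cast
        linarith
      rw [Int.cast_lt] at h1 h2
      omega
    · rw [hslt] at hlt
      have hlt' := lt_of_le_of_ne (not_lt.1 hlt) (hne _ _ a.2).symm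
      have h1 : (lam a : ℝ) < ((m a.1.2 - m a.1.1 : ℤ) : ℝ) := by
        push_cast
        linarith
      have h2 : ((m a.1.2 - m a.1.1 - 1 : ℤ) : ℝ) < ((lam a + 1 : ℤ) : ℝ) := by
        push_cast
        linarith
      rw [Int.cast_lt] at h1 h2
      omega
  have hs : ∀ r, floorVec D (simpleRoot r) = 0 := by
    intro r
    rw [← hlamD]
    have h := hxw (simpleRoot r)
    have h' := hsimple r
    have h1 : (lam (simpleRoot r) : ℝ) < ((1 : ℤ) : ℝ) := by
      push_cast
      exact h.1.trans h'.2
    have h2 : ((0 : ℤ) : ℝ) < ((lam (simpleRoot r) + 1 : ℤ) : ℝ) := by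
      push_cast
      exact h'.1.trans h.2
    rw [Int.cast_lt] at h1 h2
    omega
  let e : Fin (n + 1) ≃ ZMod (n + 1) := s
  obtain ⟨c, hc, he⟩ := exists_circularPermutation hn e
  have hDe : ∀ i, (D i : ZMod (n + 1)) = e i := by
    intro i
    have hval : (((s i).val : ℕ) : ZMod (n + 1)) = e i := ZMod.natCast_zmod_val (e i)
    have hzero : ((n : ZMod (n + 1)) + 1) = 0 := by exact_mod_cast ZMod.natCast_self (n + 1)
    simp only [D]
    push_cast
    rw [hzero, zero_mul, zero_add, hval]
  refine ⟨c, hc, ?_⟩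
  rw [hlamD]
  refine component_floorVec he (fun i j => ?_) hs
  push_cast
  rw [hDe, hDe]

theorem cycleComponent_finRotate (n : ℕ) : cycleComponent (finRotate (n + 1)) = component 0 := by
  have h0 : floorVec (fun i : Fin (n + 1) => (i.val : ℤ)) = 0 := by
    funext a
    have h1 := a.1.2.isLt
    have h2 := Fin.lt_def.1 a.2
    exact Int.ediv_eq_zero_of_lt (by dsimp only; omega) (by dsimp only; omega)
  have hval : ∀ i : Fin (n + 1), ((i.val : ℕ) : ZMod (n + 1)) = Equiv.refl (Fin (n + 1)) i :=
    fun i => ZMod.natCast_zmod_val (n := n + 1) i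
  rw [← h0]
  refine (component_floorVec (isCyclicLabelling_finRotate n) (fun i j => ?_) fun r => ?_).symm
  · push_cast
    rw [hval, hval]
    rfl
  · rw [h0, Pi.zero_apply]

/-! ### The irreducible components of the Shi variety -/

theorem mem_shiVariety_iff {n : ℕ} (hn : 1 ≤ n) (x : Y n) :
    x ∈ shiVariety n ↔ ∃ c : circularPermutations n, x ∈ cycleComponent c.1 := by
  constructor
  · rintro ⟨lam, hlam, hx⟩
    obtain ⟨c, hc, h⟩ := hlam.exists_component_eq hn
    exact ⟨⟨c, hc⟩, h ▸ hx⟩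
  · rintro ⟨⟨c, hc⟩, hx⟩
    obtain ⟨e, he⟩ := exists_isCyclicLabelling hn hc
    obtain ⟨lam, hlam, h⟩ := exists_isAdmitted_component_eq he
    exact ⟨lam, hlam, h ▸ hx⟩

theorem bijOn_cycleComponent {n : ℕ} (hn : 1 ≤ n) :
    Set.BijOn cycleComponent (circularPermutations n) (H0 n) := by
  let _ := zariskiTopology (PosRoot n) ℝ
  have hanti : ∀ c c' : circularPermutations n,
      cycleComponent c.1 ⊆ cycleComponent c'.1 → c = c' := by
    rintro ⟨c, hc⟩ ⟨c', hc'⟩ h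
    obtain ⟨e, he⟩ := exists_isCyclicLabelling hn hc
    obtain ⟨e', he'⟩ := exists_isCyclicLabelling hn hc'
    exact Subtype.ext (eq_of_cycleComponent_subset hn he he' h)
  have hH0 : H0 n = Set.range fun c : circularPermutations n => cycleComponent c.1 := by
    refine image_irreducibleComponents_eq_range (shiVariety n) _ (mem_shiVariety_iff hn)
      (fun c => ?_) (fun c => ?_) hanti <;>
    · obtain ⟨e, he⟩ := exists_isCyclicLabelling hn c.2
      obtain ⟨lam, -, h⟩ := exists_isAdmitted_component_eq he
      have hne := cycleComponent_nonempty he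
      rw [← h] at hne ⊢
      first | exact isClosed_component lam | exact isIrreducible_component lam hne
  refine ⟨fun c hc => hH0 ▸ ⟨⟨c, hc⟩, rfl⟩, fun c hc c' hc' h => ?_, fun C hC => ?_⟩
  · exact congrArg Subtype.val (hanti ⟨c, hc⟩ ⟨c', hc'⟩ h.subset)
  · rw [hH0] at hC
    obtain ⟨c, rfl⟩ := hC
    exact ⟨c.1, c.2, rfl⟩

end ShiTypeA

theorem theorem1p3 (n : ℕ) (hn : 1 ≤ n) :
    (∀ w : Equiv.Perm (Fin (n + 1)), ∀ C ∈ ShiTypeA.H0 n,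
      ShiTypeA.phiRep n w '' C ∈ ShiTypeA.H0 n) ∧
    (∃ Ψ : Equiv.Perm (Fin (n + 1)) → Set (ShiTypeA.Y n),
      Set.BijOn Ψ (ShiTypeA.circularPermutations n) (ShiTypeA.H0 n) ∧
      (∀ w : Equiv.Perm (Fin (n + 1)), ∀ c ∈ ShiTypeA.circularPermutations n,
        Ψ (w * c * w⁻¹) = ShiTypeA.phiRep n w '' Ψ c) ∧
      Ψ (finRotate (n + 1)) = ShiTypeA.component 0) ∧
    (ShiTypeA.H0 n).ncard = n.factorial := by
  have hbij := ShiTypeA.bijOn_cycleComponent hn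
  refine ⟨fun w C hC => ?_, ⟨ShiTypeA.cycleComponent, hbij, fun w c _ =>
    (ShiTypeA.image_phiRep_cycleComponent w c).symm, ShiTypeA.cycleComponent_finRotate n⟩, ?_⟩
  · obtain ⟨c, hc, rfl⟩ := hbij.surjOn hC
    rw [ShiTypeA.image_phiRep_cycleComponent]
    exact hbij.mapsTo (ShiTypeA.conj_mem_circularPermutations hc w)
  · rw [← hbij.image_eq, hbij.injOn.ncard_image,
      ShiTypeA.ncard_circularPermutations hn]
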